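/- Let $R$ be an associative ring with $1$; modules are unital right $R$-modules. We use the following notions. For an infinite cardinal $\kappa$, a module is $<\kappa$-generated if it has a generating set of cardinality $<\kappa$, and $<\kappa$-presented if it is isomorphic to $F/K$ with $F$ free of rank $<\kappa$ and $K$ a $<\kappa$-generated submodule of $F$. A filtration of a module $M$ is an increasing chain $(M_\alpha\mid\alpha\le\lambda)$ of submodules, indexed by ordinals, with $M_0=0$, $M_\lambda=M$ and $M_\alpha=\bigcup_{\beta<\alpha}M_\beta$ for every limit ordinal $\alpha\le\lambda$. A module $M$ is a transfinite extension of modules in a class $\mathcal C$ if it has a filtration $(M_\alpha\mid\alpha\le\lambda)$ such that for every $\alpha<\lambda$ the module $M_{\alpha+1}/M_\alpha$ is isomorphic to a module in $\mathcal C$. A class $\mathcal A$ is closed under transfinite extensions if it contains every transfinite extension of modules in $\mathcal A$. A class $\mathcal A$ is deconstructible if there is an infinite cardinal $\kappa$ such that every module in $\mathcal A$ is a transfinite extension of $<\kappa$-presented modules belonging to $\mathcal A$. An $\aleph_1$-dense system in a module $M$ is an upward directed family $\mathcal S$ of submodules of $M$ that is closed under unions of nonempty countable well-ordered ascending chains and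 such that every countable subset of $M$ is contained in a member of $\mathcal S$. **Theorem.** Let $\mathcal A'\subseteq\mathcal A$ be classes of $R$-modules closed under isomorphisms. Assume that $\mathcal A'$ is closed under countable direct sums, and that $\mathcal A$ is deconstructible, closed under transfinite extensions and closed under direct summands. Assume moreover that $\mathcal A$ contains every module $M$ that has an $\aleph_1$-dense system all of whose members are in $\mathcal A'$. Then $\mathcal A$ contains every countable direct limit of modules in $\mathcal A'$: if $N$ is the direct limit of a direct system of modules from $\mathcal A'$ indexed by a nonempty countable directed set, then $N\in\mathcal A$. -/

import Mathlib

open CategoryTheory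
open scoped Cardinal DirectSum

universe u w

namespace ModuleClass

section Modules

variable {S : Type u} [Ring S]

/-- A module is `< κ`-generated: it has a generating set of cardinality `< κ`. -/
def IsLTGenerated (S : Type u) [Ring S] (κ : Cardinal.{u}) (M : Type u) [AddCommGroup M]
    [Module S M] : Prop :=
  ∃ X : Set M, #X < κ ∧ Submodule.span S X = ⊤

/-- A module is `< κ`-presented: it is an epimorphic image of a free module on fewer than `κ`
generators, with a `< κ`-generated kernel. -/
def IsLTPresented (S : Type u) [Ring S] (κ : Cardinal.{u}) (M : Type u) [AddCommGroup M]
    [Module S M] : Prop :=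
  ∃ (B : Type u) (p : (B →₀ S) →ₗ[S] M),
    #B < κ ∧ Function.Surjective p ∧ IsLTGenerated S κ (LinearMap.ker p)

/-- `(F α ∣ α ≤ l)` is a filtration of `M`: an increasing continuous chain of submodules from `0`
to `M`. (The values `F α` for `α > l` are irrelevant. The union of a nonempty chain of submodules
is its supremum.) -/
structure IsFiltration {M : Type u} [AddCommGroup M] [Module S M] (l : Ordinal.{u})
    (F : Ordinal.{u} → Submodule S M) : Prop where
  zero : F 0 = ⊥
  mono : ∀ α β : Ordinal.{u}, α ≤ β → β ≤ l → F α ≤ F β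
  top : F l = ⊤
  limit : ∀ α : Ordinal.{u}, α ≤ l → Order.IsSuccLimit α → F α = ⨆ β : Set.Iio α, F β

/-- `M` is a transfinite extension of modules in `C`: it has a filtration all of whose consecutive
factors `F (α + 1) / F α`, `α < l`, are isomorphic to modules in `C`. -/
def IsTransfiniteExtension (C : ObjectProperty (ModuleCat.{u} S)) (M : ModuleCat.{u} S) : Prop :=
  ∃ (l : Ordinal.{u}) (F : Ordinal.{u} → Submodule S M), IsFiltration l F ∧
    ∀ α < l, ∃ X : ModuleCat.{u} S, C X ∧
      Nonempty ((↥(F (Order.succ α)) ⧸ (F α).submoduleOf (F (Order.succ α))) ≃ₗ[S] X)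

/-- `A` contains every transfinite extension of modules in `A`. -/
def ClosedUnderTransfiniteExtensions (A : ObjectProperty (ModuleCat.{u} S)) : Prop :=
  ∀ M : ModuleCat.{u} S, IsTransfiniteExtension A M → A M

/-- `A` is `κ`-deconstructible: every module in `A` is a transfinite extension of `< κ`-presented
modules in `A`. -/
def IsDeconstructibleAt (κ : Cardinal.{u}) (A : ObjectProperty (ModuleCat.{u} S)) : Prop :=
  ∀ M : ModuleCat.{u} S, A M → IsTransfiniteExtension (fun X => A X ∧ IsLTPresented S κ X) M

/-- `A` is `κ`-deconstructible for some infinite cardinal `κ`. -/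
def IsDeconstructible (A : ObjectProperty (ModuleCat.{u} S)) : Prop :=
  ∃ κ : Cardinal.{u}, ℵ₀ ≤ κ ∧ IsDeconstructibleAt κ A

/-- `A` contains every direct summand of a module in `A`. -/
def ClosedUnderDirectSummands (A : ObjectProperty (ModuleCat.{u} S)) : Prop :=
  ∀ M N K : ModuleCat.{u} S, Nonempty (M ≃ₗ[S] N × K) → A M → A N

/-- `A` contains the direct sum of every countable (finite or infinite) family of modules in
`A`. -/
def ClosedUnderCountableDirectSums (A : ObjectProperty (ModuleCat.{u} S)) : Prop :=
  ∀ (ι : Type u) [Countable ι] (G : ι → ModuleCat.{u} S), (∀ i, A (G i)) →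
    A (ModuleCat.of S (⨁ i, G i))

/-- `D` is a `κ`-dense system in `M`: an upward directed family of submodules that is closed under
unions of (nonempty) well-ordered ascending chains of length `< κ` and such that every subset
of `M` of cardinality `< κ` is contained in a member of `D`. -/
structure IsDenseSystem (κ : Cardinal.{u}) {M : Type u} [AddCommGroup M] [Module S M]
    (D : Set (Submodule S M)) : Prop where
  directed : DirectedOn (· ≤ ·) D
  chain : ∀ l : Ordinal.{u}, 0 < l → l < κ.ord → ∀ c : Set.Iio l → Submodule S M,
    Monotone c → (∀ α, c α ∈ D) → (⨆ α, c α) ∈ D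
  cover : ∀ X : Set M, #X < κ → ∃ N ∈ D, X ⊆ (N : Set M)

/-- `M` possesses a `κ`-dense system consisting of modules in `C`. -/
def HasDenseSystem (κ : Cardinal.{u}) (C : ObjectProperty (ModuleCat.{u} S))
    (M : ModuleCat.{u} S) : Prop :=
  ∃ D : Set (Submodule S M), IsDenseSystem κ D ∧ ∀ N ∈ D, C (ModuleCat.of S N)

end Modules

end ModuleClass

/-! A cofinal sequence reduces the claim to the colimit `N` of a sequence `P n` in `A'`. Choose a
cardinal `κ` of cofinality `ℵ₀` bounding the ring, the `P n` and the deconstructibility cardinal.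
The tree of finite sequences in a set of size `κ` then has at most `κ` nodes but `κ ^ ℵ₀ > κ`
branches. Inside the product of the modules `P n` over the nodes, the tree module is generated by
copies of the `P n` running along branches. Countably many branches generate a countable direct sum
of terms `P n` (`exists_branchSum_equiv`), so the tree module has an `ℵ₁`-dense system in `A'` and
lies in `A`.

Deconstructibility and a Hill-type argument
(`exists_small_submodule_quotient_isTransfiniteExtension`) give a submodule `L` of size at most `κ`
that contains every element supported at one node and has quotient in `A`. An element of the tree
module has nonzero limit along only finitely many branches, so by counting some branch `b` has zero
limit on all of `L`. The limit along `b` maps the quotient onto `N`. Modulo `L` the copies of the `P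
n` along `b` become compatible and split this map (`nonempty_quotient_equiv_prod`). Hence `N` is a
direct summand of a module in `A`. -/

namespace ModuleClass

/-! ### Cardinal bounds. -/

section Cardinality

universe v

lemma mk_iUnion_le_of_le {ι α : Type v} {κ : Cardinal.{v}} (hκ : ℵ₀ ≤ κ) (f : ι → Set α)
    (hι : #ι ≤ κ) (hf : ∀ i, #(f i) ≤ κ) : #(⋃ i, f i) ≤ κ :=
  (Cardinal.mk_iUnion_le_sum_mk.trans (Cardinal.sum_le_sum _ _ hf)).trans <| by
    rw [Cardinal.sum_const']
    exact (mul_le_mul_left hι κ).trans (Cardinal.mul_eq_self hκ).le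

/-- A small set is contained in a small set closed under a set-valued operation with small
values. -/
lemma exists_closed_superset {J : Type v} {κ : Cardinal.{v}} (hκ : ℵ₀ ≤ κ) (c : J → Set J)
    (hc : ∀ j, #(c j) ≤ κ) (X : Set J) (hX : #X ≤ κ) :
    ∃ S : Set J, X ⊆ S ∧ #S ≤ κ ∧ ∀ j ∈ S, c j ⊆ S := by
  let step : Set J → Set J := fun S => ⋃ j : S, c j
  have hstep : ∀ S : Set J, #S ≤ κ → #(step S) ≤ κ := fun S hS =>
    mk_iUnion_le_of_le hκ _ hS fun j => hc j
  have hit : ∀ n : ℕ, #(step^[n] X : Set J) ≤ κ := by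
    intro n
    induction n with
    | zero => exact hX
    | succ n ih => rw [Function.iterate_succ_apply']; exact hstep _ ih
  refine ⟨⋃ n : ULift.{v} ℕ, step^[n.down] X, fun x hx => Set.mem_iUnion.2 ⟨⟨0⟩, hx⟩,
    mk_iUnion_le_of_le hκ _ (by simpa using hκ) fun n => hit _, fun j hj x hx => ?_⟩
  obtain ⟨⟨n⟩, hn⟩ := Set.mem_iUnion.1 hj
  refine Set.mem_iUnion.2 ⟨⟨n + 1⟩, ?_⟩
  simp only [Function.iterate_succ_apply']
  exact Set.mem_iUnion.2 ⟨⟨j, hn⟩, hx⟩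

lemma mk_finsupp_le {S B : Type v} [Zero S] {κ : Cardinal.{v}} (hκ : ℵ₀ ≤ κ) (hS : #S ≤ κ)
    (hB : #B ≤ κ) : #(B →₀ S) ≤ κ := by
  rcases isEmpty_or_nonempty B with h | h
  · exact (Cardinal.le_one_iff_subsingleton.2 inferInstance).trans
      (Cardinal.one_le_aleph0.trans hκ)
  rcases subsingleton_or_nontrivial S with h | h
  · exact (Cardinal.le_one_iff_subsingleton.2 inferInstance).trans
      (Cardinal.one_le_aleph0.trans hκ)
  rcases finite_or_infinite B with h' | h'
  · rcases finite_or_infinite S with h'' | h''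
    · have : Finite (B →₀ S) := Finite.of_injective _ DFunLike.coe_injective
      exact (Cardinal.lt_aleph0_of_finite _).le.trans hκ
    · rw [Cardinal.mk_finsupp_of_infinite']; exact max_le hB hS
  · rw [Cardinal.mk_finsupp_of_infinite]; exact max_le hB hS

lemma mk_span_le {S M : Type v} [Ring S] [AddCommGroup M] [Module S M] {κ : Cardinal.{v}}
    (hκ : ℵ₀ ≤ κ) (hS : #S ≤ κ) {X : Set M} (hX : #X ≤ κ) : #(Submodule.span S X) ≤ κ := by
  have h : Function.Surjective (Finsupp.linearCombination S (Subtype.val : X → M)).rangeRestrict :=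
    LinearMap.surjective_rangeRestrict _
  have := (Cardinal.mk_le_of_surjective h).trans (mk_finsupp_le hκ hS hX)
  rwa [Finsupp.range_linearCombination, Subtype.range_coe] at this

lemma IsLTPresented.mk_le {S : Type u} [Ring S] {μ κ : Cardinal.{u}} {M : Type u}
    [AddCommGroup M] [Module S M] (h : IsLTPresented S μ M) (hκ : ℵ₀ ≤ κ) (hS : #S ≤ κ)
    (hμ : μ ≤ κ) : #M ≤ κ := by
  obtain ⟨B, p, hB, hp, -⟩ := h
  exact (Cardinal.mk_le_of_surjective hp).trans (mk_finsupp_le hκ hS (hB.le.trans hμ))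

/-- A cardinal `ℵ_ (α + ω)` has cofinality `ℵ₀`, so König's theorem gives the strict inequality. -/
lemma exists_le_lt_pow_aleph0 (c : Cardinal.{u}) :
    ∃ κ : Cardinal.{u}, c ≤ κ ∧ ℵ₀ ≤ κ ∧ κ < κ ^ (ℵ₀ : Cardinal.{u}) := by
  have hl : Order.IsSuccLimit (c.ord + Ordinal.omega0) :=
    Ordinal.isSuccLimit_add _ Ordinal.isSuccLimit_omega0
  refine ⟨ℵ_ (c.ord + Ordinal.omega0), ?_, Cardinal.aleph0_le_aleph _, ?_⟩
  · have h1 : c.ord ≤ Ordinal.omega (c.ord + Ordinal.omega0) :=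
      le_self_add.trans (Ordinal.le_omega_self _)
    have := Ordinal.card_le_card h1
    simpa using this
  · have := Cardinal.lt_power_cof_ord (Cardinal.aleph0_le_aleph (c.ord + Ordinal.omega0))
    rwa [Cardinal.ord_aleph, Ordinal.cof_omega hl, Ordinal.cof_add _ Ordinal.omega0_ne_zero,
      Ordinal.cof_omega0] at this

end Cardinality

/-! ### A Hill-type lemma: small submodules with filtered quotients. -/

section Hill

variable {S : Type u} [Ring S] {M : Type u} [AddCommGroup M] [Module S M]

/-- `A α` is spanned by one representative of each coset of `F α` in `F (succ α)`. -/
lemma IsFiltration.exists_small_complements {κ : Cardinal.{u}} (hκ : ℵ₀ ≤ κ) (hS : #S ≤ κ)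
    {l : Ordinal.{u}} {F : Ordinal.{u} → Submodule S M}
    (hsmall : ∀ α < l, #(↥(F (Order.succ α)) ⧸ (F α).submoduleOf (F (Order.succ α))) ≤ κ) :
    ∃ A : Ordinal.{u} → Submodule S M, ∀ α < l, #(A α) ≤ κ ∧ A α ≤ F (Order.succ α) ∧
      F (Order.succ α) ≤ F α ⊔ A α := by
  have : ∀ α : Ordinal.{u}, ∃ A : Submodule S M, α < l → #A ≤ κ ∧ A ≤ F (Order.succ α) ∧
      F (Order.succ α) ≤ F α ⊔ A := by
    intro α
    by_cases hα : α < l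
    · let Q := ↥(F (Order.succ α)) ⧸ (F α).submoduleOf (F (Order.succ α))
      let g : Q → M := fun q => (Quotient.out q : F (Order.succ α))
      refine ⟨Submodule.span S (Set.range g), fun _ => ⟨?_, ?_, ?_⟩⟩
      · exact mk_span_le hκ hS (Cardinal.mk_range_le.trans (hsmall α hα))
      · rw [Submodule.span_le]
        rintro _ ⟨q, rfl⟩
        exact Subtype.coe_prop _
      · intro x hx
        let q : Q := Submodule.Quotient.mk ⟨x, hx⟩
        have hq : (Submodule.Quotient.mk (Quotient.out q) : Q) = q := Quotient.out_eq q
        have h1 := (Submodule.Quotient.eq _).1 hq.symm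
        change ((⟨x, hx⟩ - Quotient.out q : F (Order.succ α)) : M) ∈ F α at h1
        have h2 : x = (x - g q) + g q := by abel
        rw [h2]
        exact Submodule.add_mem_sup h1 (Submodule.subset_span ⟨q, rfl⟩)
    · exact ⟨⊥, fun h => absurd h hα⟩
  choose A hA using this
  exact ⟨A, hA⟩

lemma IsFiltration.le_biSup_complements {l : Ordinal.{u}} {F A : Ordinal.{u} → Submodule S M}
    (hF : IsFiltration l F) (hA : ∀ α < l, F (Order.succ α) ≤ F α ⊔ A α) (α : Ordinal.{u})
    (hα : α ≤ l) : F α ≤ ⨆ β ∈ Set.Iio α, A β := by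
  induction α using Ordinal.limitRecOn with
  | zero => rw [hF.zero]; exact bot_le
  | add_one α ih =>
    rw [← Order.succ_eq_add_one] at hα ⊢
    have hα' : α < l := Order.succ_le_iff.1 hα
    refine (hA α hα').trans (sup_le ((ih hα'.le).trans ?_) ?_)
    · exact biSup_mono fun β hβ => lt_trans hβ (Order.lt_succ α)
    · exact le_biSup A (show α ∈ Set.Iio (Order.succ α) from Order.lt_succ α)
  | limit α hlim ih =>
    rw [hF.limit α hα hlim]
    refine iSup_le fun β => (ih β β.2 (le_of_lt (lt_of_lt_of_le β.2 hα))).trans ?_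
    exact biSup_mono fun γ hγ => Set.mem_Iio.2 (lt_trans hγ β.2)

/-- Each element already lies in a finite subsum. The lift appears because sets of ordinals live one
universe higher. -/
lemma exists_index_set_of_subset_biSup {κ : Cardinal.{u}} (hκ : ℵ₀ ≤ κ)
    {A : Ordinal.{u} → Submodule S M} {T : Set Ordinal.{u}} {X : Set M} (hX : #X ≤ κ)
    (h : ∀ x ∈ X, x ∈ ⨆ β ∈ T, A β) :
    ∃ s : Set Ordinal.{u}, s ⊆ T ∧ #s ≤ Cardinal.lift.{u + 1} κ ∧ ∀ x ∈ X, x ∈ ⨆ β ∈ s, A β := by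
  have key : ∀ x : X, ∃ s : Set Ordinal.{u}, s ⊆ T ∧ s.Finite ∧ (x : M) ∈ ⨆ β ∈ s, A β := by
    intro x
    have hx := h x x.2
    rw [iSup_subtype', Submodule.mem_iSup_iff_exists_finset] at hx
    obtain ⟨s, hs⟩ := hx
    refine ⟨Subtype.val '' (s : Set T), by rintro _ ⟨y, -, rfl⟩; exact y.2,
      s.finite_toSet.image _, ?_⟩
    refine (?_ : (⨆ i ∈ s, A i) ≤ _) hs
    exact iSup₂_le fun i hi => le_biSup A (Set.mem_image_of_mem _ hi)
  choose s hsT hsf hs using key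
  refine ⟨⋃ x : ULift.{u + 1} X, s x.down, Set.iUnion_subset fun x => hsT _,
    mk_iUnion_le_of_le (by simpa using hκ) _ ?_ fun x => ?_, fun x hx => ?_⟩
  · rw [Cardinal.mk_uLift]; exact Cardinal.lift_le.2 hX
  · exact ((Cardinal.lt_aleph0_iff_finite.2 (hsf _)).le).trans (by simpa using hκ)
  · exact (biSup_mono fun β hβ => Set.mem_iUnion.2 ⟨⟨x, hx⟩, hβ⟩ :
      (⨆ β ∈ s ⟨x, hx⟩, A β) ≤ _) (hs ⟨x, hx⟩)

lemma mk_biSup_le {κ : Cardinal.{u}} (hκ : ℵ₀ ≤ κ) (hS : #S ≤ κ)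
    {A : Ordinal.{u} → Submodule S M} {s : Set Ordinal.{u}} (hs : #s ≤ Cardinal.lift.{u + 1} κ)
    (hA : ∀ α ∈ s, #(A α) ≤ κ) : #(⨆ α ∈ s, A α : Submodule S M) ≤ κ := by
  obtain ⟨c, hc⟩ := Cardinal.mem_range_lift_of_le hs
  have hcκ : c ≤ κ := by rw [← hc] at hs; exact Cardinal.lift_le.1 hs
  induction c using Cardinal.inductionOn with | _ J
  rw [← Cardinal.mk_uLift, Cardinal.eq] at hc
  obtain ⟨e⟩ := hc
  have h1 : (⨆ α ∈ s, A α) = Submodule.span S (⋃ j : J, (A (e ⟨j⟩) : Set M)) := by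
    rw [Submodule.span_iUnion, iSup_subtype']
    simp only [Submodule.span_eq]
    exact ((Equiv.ulift.symm.trans e).iSup_comp (g := fun x : s => A x)).symm
  rw [h1]
  exact mk_span_le hκ hS (mk_iUnion_le_of_le hκ _ hcκ fun j => hA _ (e _).2)

/-- Submodules spanned along a closed set of indices meet the filtration in the expected way. -/
lemma inf_le_biSup_of_closed {l : Ordinal.{u}} {F A : Ordinal.{u} → Submodule S M}
    (hF : IsFiltration l F) (hA : ∀ α < l, A α ≤ F (Order.succ α))
    {c : Ordinal.{u} → Set Ordinal.{u}}
    (hcα : ∀ α, c α ⊆ Set.Iio α) (hc : ∀ α < l, A α ⊓ F α ≤ ⨆ β ∈ c α, A β)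
    {T : Set Ordinal.{u}} (hT : T ⊆ Set.Iio l) (hTc : ∀ α ∈ T, c α ⊆ T) (α : Ordinal.{u}) :
    (⨆ β ∈ T, A β) ⊓ F α ≤ ⨆ β ∈ T ∩ Set.Iio α, A β := by
  have hle : ∀ γ ≤ l, ∀ s ⊆ Set.Iio γ, (⨆ β ∈ s, A β) ≤ F γ := fun γ hγ s hs =>
    iSup₂_le fun β hβ => (hA β ((hs hβ).trans_le hγ)).trans
      (hF.mono _ _ (Order.succ_le_of_lt (hs hβ)) hγ)
  -- The auxiliary bound `γ` on the indices representing `x` is lowered by well-founded induction.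
  have key : ∀ γ : Ordinal.{u}, ∀ x ∈ ⨆ β ∈ T ∩ Set.Iio γ, A β, x ∈ F α →
      x ∈ ⨆ β ∈ T ∩ Set.Iio α, A β := by
    intro γ
    induction γ using WellFoundedLT.induction with
    | ind γ ih =>
    intro x hx hxα
    have hx' := hx
    rw [iSup_subtype', Submodule.mem_iSup_iff_exists_finset] at hx'
    obtain ⟨s, hs⟩ := hx'
    rcases s.eq_empty_or_nonempty with rfl | hne
    · have : x = 0 := by simpa using hs
      rw [this]; exact zero_mem _
    let δ := s.max' hne
    have hδs : δ ∈ s := s.max'_mem hne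
    have hsδ : (⨆ i ∈ s, A i) ≤ A δ ⊔ ⨆ β ∈ T ∩ Set.Iio (δ : Ordinal), A β := by
      refine iSup₂_le fun i hi => ?_
      rcases (s.le_max' i hi).eq_or_lt with h | h
      · rw [h]; exact le_sup_left
      · exact le_sup_of_le_right
          (le_biSup A (show (i : Ordinal) ∈ T ∩ Set.Iio (δ : Ordinal) from ⟨i.2.1, h⟩))
    rcases lt_or_ge (δ : Ordinal) α with hδ | hδ
    · refine (hsδ.trans (sup_le
        (le_biSup A (show (δ : Ordinal) ∈ T ∩ Set.Iio α from ⟨δ.2.1, hδ⟩)) ?_)) hs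
      exact biSup_mono fun β hβ => ⟨hβ.1, lt_trans hβ.2 hδ⟩
    -- The largest index `δ` is at least `α`, so the component `a = x - y` lies in `A δ ⊓ F δ`.
    -- Closedness rewrites it with indices in `c δ`, all below `δ`.
    · have hδl : (δ : Ordinal) < l := hT δ.2.1
      obtain ⟨a, ha, y, hy, hay⟩ := Submodule.mem_sup.1 (hsδ hs)
      have hyF : y ∈ F δ := hle δ hδl.le _ Set.inter_subset_right hy
      have haF : a ∈ F δ := by
        have : a = x - y := by rw [← hay]; abel
        rw [this]
        exact sub_mem (hF.mono _ _ hδ hδl.le hxα) hyF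
      have ha' : a ∈ ⨆ β ∈ T ∩ Set.Iio (δ : Ordinal), A β :=
        (biSup_mono fun β hβ => ⟨hTc δ δ.2.1 hβ, hcα δ hβ⟩ : (⨆ β ∈ c δ, A β) ≤ _)
          (hc δ hδl (Submodule.mem_inf.2 ⟨ha, haF⟩))
      exact ih δ δ.2.2 x (hay ▸ add_mem ha' hy) hxα
  rintro x ⟨hx, hxα⟩
  exact key l x (by rwa [Set.inter_eq_left.2 hT]) hxα

/-- The consecutive factors of the image of a chain modulo a submodule `L` are unchanged if `L`
meets the larger member inside the smaller one. -/
lemma nonempty_factor_equiv (L P Q : Submodule S M) (hPQ : P ≤ Q) (h : L ⊓ Q ≤ P) :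
    Nonempty ((↥(Q.map L.mkQ) ⧸ (P.map L.mkQ).submoduleOf (Q.map L.mkQ)) ≃ₗ[S]
      (↥Q ⧸ P.submoduleOf Q)) := by
  let φ : Q →ₗ[S] (↥(Q.map L.mkQ) ⧸ (P.map L.mkQ).submoduleOf (Q.map L.mkQ)) :=
    (Submodule.mkQ _).comp (L.mkQ.submoduleMap Q)
  have hφ : Function.Surjective φ :=
    (Submodule.mkQ_surjective _).comp (LinearMap.submoduleMap_surjective _ _)
  have hker : LinearMap.ker φ = P.submoduleOf Q := by
    ext x
    rw [LinearMap.mem_ker]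
    change Submodule.Quotient.mk _ = _ ↔ (x : M) ∈ P
    rw [Submodule.Quotient.mk_eq_zero]
    change L.mkQ (x : M) ∈ P.map L.mkQ ↔ _
    constructor
    · rintro ⟨p, hp, hpx⟩
      have h1 : (x : M) - p ∈ L := (Submodule.Quotient.eq L).1 hpx.symm
      have h2 : (x : M) - p ∈ P := h ⟨h1, sub_mem x.2 (hPQ hp)⟩
      simpa using add_mem h2 hp
    · intro hx
      exact ⟨x, hx, rfl⟩
  exact ⟨((Submodule.quotEquivOfEq _ _ hker.symm).trans
    (φ.quotKerEquivOfSurjective hφ)).symm⟩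

/-- Take `L` to be the sum of the `A β` over a small set `T` of indices closed under `c`. In the
image of the filtration modulo `L`, the factor at `α` vanishes for `α ∈ T` and is unchanged for `α ∉
T`. The vanishing factors account for the alternative `Subsingleton Y`. -/
lemma exists_small_submodule_quotient_isTransfiniteExtension {κ : Cardinal.{u}} (hκ : ℵ₀ ≤ κ)
    (hS : #S ≤ κ) {C : ObjectProperty (ModuleCat.{u} S)} (hC : ∀ X, C X → #X ≤ κ)
    {M : ModuleCat.{u} S} (hM : IsTransfiniteExtension C M) (X : Set M) (hX : #X ≤ κ) :
    ∃ L : Submodule S M, X ⊆ L ∧ #L ≤ κ ∧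
      IsTransfiniteExtension (fun Y => C Y ∨ Subsingleton Y) (ModuleCat.of S (M ⧸ L)) := by
  obtain ⟨l, F, hF, hfac⟩ := hM
  obtain ⟨A, hA⟩ := IsFiltration.exists_small_complements (F := F) hκ hS (l := l) (by
    intro α hα
    obtain ⟨Y, hY, ⟨e⟩⟩ := hfac α hα
    exact (Cardinal.mk_congr e.toEquiv).trans_le (hC Y hY))
  have hspan := fun α hα => hF.le_biSup_complements (fun α hα => (hA α hα).2.2) α hα
  have hκ' : ℵ₀ ≤ Cardinal.lift.{u + 1} κ := by simpa using hκ
  have hcex : ∀ α : Ordinal.{u}, ∃ c : Set Ordinal.{u}, c ⊆ Set.Iio α ∧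
      #c ≤ Cardinal.lift.{u + 1} κ ∧ (α < l → A α ⊓ F α ≤ ⨆ β ∈ c, A β) := by
    intro α
    by_cases hα : α < l
    · obtain ⟨c, h1, h2, h3⟩ := exists_index_set_of_subset_biSup hκ (A := A) (T := Set.Iio α)
        (X := (A α ⊓ F α : Submodule S M))
        ((Cardinal.mk_le_mk_of_subset (fun x hx => hx.1)).trans (hA α hα).1)
        (fun x hx => hspan α hα.le hx.2)
      exact ⟨c, h1, h2, fun _ => h3⟩
    · exact ⟨∅, Set.empty_subset _, by simp, fun h => absurd h hα⟩
  choose c hcα hcκ hc using hcex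
  obtain ⟨T₀, hT₀l, hT₀, hXT₀⟩ := exists_index_set_of_subset_biSup hκ (A := A) (T := Set.Iio l)
    hX (fun x _ => hspan l le_rfl (by rw [hF.top]; trivial))
  obtain ⟨T', hT₀T', hT'κ, hT'c⟩ := exists_closed_superset hκ' c hcκ T₀ hT₀
  -- Truncating at `l` keeps the set closed, since `c α` only contains indices below `α`.
  let T := T' ∩ Set.Iio l
  have hTl : T ⊆ Set.Iio l := Set.inter_subset_right
  have hTc : ∀ α ∈ T, c α ⊆ T := fun α hα β hβ =>
    ⟨hT'c α hα.1 hβ, Set.mem_Iio.2 (lt_trans (hcα α hβ) hα.2)⟩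
  have hTκ : #T ≤ Cardinal.lift.{u + 1} κ :=
    (Cardinal.mk_le_mk_of_subset Set.inter_subset_left).trans hT'κ
  let L : Submodule S M := ⨆ β ∈ T, A β
  have hint := inf_le_biSup_of_closed hF (fun α hα => (hA α hα).2.1) hcα hc hTl hTc
  refine ⟨L, fun x hx => (biSup_mono fun β hβ => ⟨hT₀T' hβ, hT₀l hβ⟩ :
    (⨆ β ∈ T₀, A β) ≤ L) (hXT₀ x hx), mk_biSup_le hκ hS hTκ fun α hα => (hA α (hTl hα)).1,
    l, fun α => (F α).map L.mkQ, ⟨?_, ?_, ?_, ?_⟩, fun α hα => ?_⟩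
  · rw [hF.zero, Submodule.map_bot]
  · exact fun α β h h' => Submodule.map_mono (hF.mono α β h h')
  · rw [hF.top, Submodule.map_top, Submodule.range_mkQ]
  · intro α hα hlim
    rw [hF.limit α hα hlim, Submodule.map_iSup]
  · by_cases hαT : α ∈ T
    · refine ⟨ModuleCat.of S PUnit, Or.inr inferInstance, ?_⟩
      have hle : (F (Order.succ α)).map L.mkQ ≤ (F α).map L.mkQ := by
        refine (Submodule.map_mono (hA α hα).2.2).trans ?_
        rw [Submodule.map_sup]
        refine sup_le le_rfl ?_
        rintro _ ⟨a, ha, rfl⟩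
        have : L.mkQ a = 0 := (Submodule.Quotient.mk_eq_zero L).2 (le_biSup A hαT ha)
        rw [this]; exact zero_mem _
      have : Subsingleton (↥((F (Order.succ α)).map L.mkQ) ⧸
          ((F α).map L.mkQ).submoduleOf ((F (Order.succ α)).map L.mkQ)) := by
        rw [Submodule.submoduleOf_eq_top.2 hle]
        infer_instance
      exact ⟨LinearEquiv.ofSubsingleton _ _⟩
    · obtain ⟨Y, hY, ⟨e⟩⟩ := hfac α hα
      obtain ⟨e'⟩ := nonempty_factor_equiv L (F α) (F (Order.succ α))
        (hF.mono _ _ (Order.le_succ α) (Order.succ_le_of_lt hα)) (by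
          refine (hint (Order.succ α)).trans (iSup₂_le fun β hβ => ?_)
          have hβα : β < α := (Order.lt_succ_iff.1 hβ.2).lt_of_ne fun h => hαT (h ▸ hβ.1)
          exact (hA β (hβα.trans hα)).2.1.trans (hF.mono _ _ (Order.succ_le_of_lt hβα) hα.le))
      exact ⟨Y, Or.inl hY, ⟨e'.trans e⟩⟩

end Hill

/-! ### The tree module and its dense system. -/

section TreeModule

open Filter

/-- Nodes of the tree of finite sequences in `K`. -/
abbrev Node (K : Type u) : Type u := Σ n : ℕ, (Fin n → K)

/-- The node of height `n` on the branch `b`. -/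
abbrev node {K : Type u} (b : ℕ → K) (n : ℕ) : Node K := ⟨n, fun i => b i⟩

lemma node_eq_node_iff {K : Type u} {b b' : ℕ → K} {n : ℕ} :
    node b n = node b' n ↔ ∀ i < n, b i = b' i := by
  constructor
  · intro h i hi
    exact congrFun (eq_of_heq (Sigma.mk.inj h).2) ⟨i, hi⟩
  · intro h
    exact congrArg (Sigma.mk n) (funext fun i => h i i.2)

lemma eventually_node_ne {K : Type u} {b b' : ℕ → K} (h : b ≠ b') :
    ∀ᶠ n in atTop, node b n ≠ node b' n := by
  obtain ⟨i, hi⟩ := Function.ne_iff.1 h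
  filter_upwards [eventually_gt_atTop i] with n hn h'
  exact hi (node_eq_node_iff.1 h' i hn)

lemma exists_eq_node {K : Type u} [Nonempty K] (τ : Node K) : ∃ b : ℕ → K, τ = node b τ.1 := by
  refine ⟨fun n => if h : n < τ.1 then τ.2 ⟨n, h⟩ else Classical.arbitrary K, ?_⟩
  exact congrArg (Sigma.mk τ.1) (funext fun i => by simp)

lemma mk_node_le {K : Type u} {κ : Cardinal.{u}} (hκ : ℵ₀ ≤ κ) (hK : #K = κ) :
    #(Node K) ≤ κ := by
  have : Infinite K := Cardinal.infinite_iff.2 (hK ▸ hκ)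
  refine (Cardinal.mk_le_of_injective (f := fun τ : Node K => List.ofFn τ.2) ?_).trans
    ((Cardinal.mk_list_eq_mk K).trans hK).le
  rintro ⟨n, x⟩ ⟨m, y⟩ h
  exact List.ofFn_inj'.1 h

variable {S : Type u} [Ring S] {K : Type u} {P : ℕ → Type u} [∀ n, AddCommGroup (P n)]
  [∀ n, Module S (P n)] (F : ∀ n m, n ≤ m → P n →ₗ[S] P m)

open Classical in
/-- The embedding of the `n`-th term of the sequence along the part of the branch `b` above its
`n`-th node. -/
noncomputable def branchMap (b : ℕ → K) (n : ℕ) : P n →ₗ[S] ((τ : Node K) → P τ.1) :=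
  LinearMap.pi fun τ => if h : n ≤ τ.1 ∧ τ = node b τ.1 then F n τ.1 h.1 else 0

lemma branchMap_apply_of_pos (b : ℕ → K) (n : ℕ) (x : P n) (τ : Node K) (h : n ≤ τ.1)
    (h' : τ = node b τ.1) : branchMap F b n x τ = F n τ.1 h x := by
  simp only [branchMap, LinearMap.pi_apply]
  rw [dif_pos ⟨h, h'⟩]

lemma branchMap_apply_of_neg (b : ℕ → K) (n : ℕ) (x : P n) (τ : Node K)
    (h : ¬ (n ≤ τ.1 ∧ τ = node b τ.1)) : branchMap F b n x τ = 0 := by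
  simp only [branchMap, LinearMap.pi_apply]
  rw [dif_neg h]; rfl

/-- The submodule generated by the branches in `B`. -/
noncomputable def branchSum (B : Set (ℕ → K)) : Submodule S ((τ : Node K) → P τ.1) :=
  ⨆ b ∈ B, ⨆ n, LinearMap.range (branchMap F b n)

variable (K) in
/-- The tree module of a sequence of modules: the submodule generated by all branches. -/
noncomputable abbrev treeModule : Submodule S ((τ : Node K) → P τ.1) :=
  branchSum F (Set.univ : Set (ℕ → K))

lemma branchMap_mem_branchSum {B : Set (ℕ → K)} {b : ℕ → K} (hb : b ∈ B) (n : ℕ) (x : P n) :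
    branchMap F b n x ∈ branchSum F B :=
  (le_biSup (fun b => ⨆ n, LinearMap.range (branchMap F b n)) hb)
    ((le_iSup (fun n => LinearMap.range (branchMap F b n)) n) ⟨x, rfl⟩)

lemma branchSum_le {B : Set (ℕ → K)} {W : Submodule S ((τ : Node K) → P τ.1)}
    (h : ∀ b ∈ B, ∀ n x, branchMap F b n x ∈ W) : branchSum F B ≤ W := by
  refine iSup₂_le fun b hb => iSup_le fun n => ?_
  rintro _ ⟨x, rfl⟩
  exact h b hb n x

lemma branchSum_mono {B B' : Set (ℕ → K)} (h : B ⊆ B') : branchSum F B ≤ branchSum F B' :=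
  branchSum_le F fun _ hb n x => branchMap_mem_branchSum F (h hb) n x

variable {F}
variable (hid : ∀ n x, F n n le_rfl x = x)
  (hcomp : ∀ n m k (h : n ≤ m) (h' : m ≤ k) x, F m k h' (F n m h x) = F n k (h.trans h') x)

open Classical in
include hid hcomp in
lemma branchMap_eq_single_add (b : ℕ → K) (n : ℕ) (x : P n) :
    branchMap F b n x = Pi.single (M := fun τ : Node K => P τ.1) (node b n) x +
      branchMap F b (n + 1) (F n (n + 1) n.le_succ x) := by
  funext τ
  rw [Pi.add_apply]
  by_cases hτ : τ = node b τ.1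
  · rcases lt_trichotomy n τ.1 with h | h | h
    · rw [branchMap_apply_of_pos F b n x τ h.le hτ, branchMap_apply_of_pos F b _ _ τ h hτ, hcomp,
        Pi.single_eq_of_ne, zero_add]
      rintro rfl
      exact lt_irrefl _ h
    · have hτ' : τ = node b n := by rw [hτ, ← h]
      subst hτ'
      rw [branchMap_apply_of_pos F b n x _ le_rfl rfl, branchMap_apply_of_neg, Pi.single_eq_same,
        hid, add_zero]
      exact fun h => Nat.not_succ_le_self n h.1
    · rw [branchMap_apply_of_neg, branchMap_apply_of_neg, Pi.single_eq_of_ne, zero_add]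
      · rintro rfl
        exact lt_irrefl _ h
      · exact fun h' => absurd h'.1 (by omega)
      · exact fun h' => absurd h'.1 (by omega)
  · rw [branchMap_apply_of_neg, branchMap_apply_of_neg, Pi.single_eq_of_ne, zero_add]
    · rintro rfl
      exact hτ rfl
    · exact fun h => hτ h.2
    · exact fun h => hτ h.2

open Classical in
include hid hcomp in
-- Each step along the branch changes the embedding only by an element supported at one node.
lemma branchMap_sub_mem {L : Submodule S ((τ : Node K) → P τ.1)}
    (hL : ∀ (τ : Node K) (x : P τ.1), Pi.single τ x ∈ L) (b : ℕ → K) {n m : ℕ} (h : n ≤ m)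
    (x : P n) : branchMap F b n x - branchMap F b m (F n m h x) ∈ L := by
  induction m, h using Nat.le_induction with
  | base => rw [hid, sub_self]; exact zero_mem _
  | succ m h ih =>
    have h1 := branchMap_eq_single_add hid hcomp b m (F n m h x)
    rw [hcomp] at h1
    have h2 : branchMap F b n x - branchMap F b (m + 1) (F n (m + 1) (h.trans m.le_succ) x) =
        (branchMap F b n x - branchMap F b m (F n m h x)) +
          Pi.single (M := fun τ : Node K => P τ.1) (node b m) (F n m h x) := by
      rw [h1]; abel
    rw [h2]
    exact add_mem ih (hL _ _)

include hid in
-- A triangularity argument: at a node of minimal height in the support, no other summand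
-- contributes, because its branch starts at a different node of at least that height.
lemma branch_choice_injective {ι : Type u} [DecidableEq ι] (d : ι → Node K)
    (hd : Function.Injective d)
    (β : ι → ℕ → K) (hβ : ∀ i, d i = node (β i) (d i).1) :
    Function.Injective
      (DirectSum.toModule S ι _ fun i => branchMap F (β i) (d i).1) := by
  classical
  rw [injective_iff_map_eq_zero]
  intro x hx
  by_contra hne
  have hs : (DFinsupp.support x).Nonempty := by
    rw [Finset.nonempty_iff_ne_empty]
    exact fun h => hne (DFinsupp.support_eq_empty.1 h)
  obtain ⟨i, hi, hmin⟩ := Finset.exists_min_image _ (fun i => (d i).1) hs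
  have h0 : (DirectSum.toModule S ι _ fun i => branchMap F (β i) (d i).1) x (d i) = x i := by
    conv_lhs => rw [← DirectSum.sum_support_of x]
    rw [map_sum, Finset.sum_apply, Finset.sum_eq_single i]
    · rw [← DirectSum.lof_eq_of S, DirectSum.toModule_lof,
        branchMap_apply_of_pos F _ _ _ _ le_rfl (hβ i), hid]
    · intro j hj hji
      rw [← DirectSum.lof_eq_of S, DirectSum.toModule_lof]
      refine branchMap_apply_of_neg F _ _ _ _ fun h => hji (hd ?_)
      have hlen := le_antisymm h.1 (hmin j hj)
      rw [hβ j, h.2, hlen]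
    · exact fun h => absurd hi h
  rw [hx] at h0
  exact (DFinsupp.mem_support_iff.1 hi) h0.symm

include hid hcomp in
/-- The submodule generated by countably many branches is a countable direct sum of terms of the
sequence. -/
lemma exists_branchSum_equiv {B : Set (ℕ → K)} (hB : B.Countable) :
    ∃ (ι : Type u) (_ : Countable ι) (d : ι → ℕ),
      Nonempty ((⨁ i, P (d i)) ≃ₗ[S] branchSum F B) := by
  classical
  obtain ⟨e, he⟩ := Set.countable_iff_exists_injOn.1 hB
  let ι : Type u := {τ : Node K // ∃ b ∈ B, τ = node b τ.1}
  have hι : Countable ι := by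
    have : Countable B := hB
    refine Function.Surjective.countable
      (f := fun p : B × ℕ => (⟨node p.1 p.2, p.1, p.1.2, rfl⟩ : ι)) ?_
    rintro ⟨τ, b, hb, h⟩
    exact ⟨(⟨b, hb⟩, τ.1), Subtype.ext h.symm⟩
  -- Each node on a branch in `B` is assigned the first such branch through it in the enumeration
  -- `e`. This selects exactly one summand per node.
  have hmin : ∀ τ : ι, ∃ b : ℕ → K, b ∈ B ∧ τ.1 = node b τ.1.1 ∧
      ∀ b' ∈ B, τ.1 = node b' τ.1.1 → e b ≤ e b' := by
    intro τ
    obtain ⟨b, hb, h⟩ := (measure e).wf.has_min {b | b ∈ B ∧ τ.1 = node b τ.1.1}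
      (by obtain ⟨b, hb⟩ := τ.2; exact ⟨b, hb⟩)
    exact ⟨b, hb.1, hb.2, fun b' h1 h2 => not_lt.1 (h b' ⟨h1, h2⟩)⟩
  choose β hβB hβ hβmin using hmin
  let Φ := DirectSum.toModule S ι _ fun i => branchMap F (β i) i.1.1
  have hinj : Function.Injective Φ :=
    branch_choice_injective hid (fun i : ι => i.1) Subtype.val_injective β hβ
  have hdirect : ∀ (τ : ι) (x : P τ.1.1), branchMap F (β τ) τ.1.1 x ∈ LinearMap.range Φ :=
    fun τ x => ⟨DirectSum.lof S ι _ τ x, DirectSum.toModule_lof _ _ _⟩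
  have hgen : ∀ k : ℕ, ∀ b ∈ B, e b = k → ∀ n x, branchMap F b n x ∈ LinearMap.range Φ := by
    intro k
    induction k using Nat.strong_induction_on with
    | _ k ih =>
    intro b hb hk
    -- Only finitely many branches precede `b`, so above some height `m₀` it has left them all and
    -- is the branch assigned to its own nodes.
    have hfin : {b' | b' ∈ B ∧ e b' ≤ e b ∧ b' ≠ b}.Finite := by
      refine Set.Finite.of_finite_image ((Set.finite_Iic (e b)).subset ?_)
        (he.mono fun x hx => hx.1)
      rintro _ ⟨b', hb', rfl⟩
      exact hb'.2.1
    have hev : ∀ᶠ m in atTop, ∀ b' ∈ {b' | b' ∈ B ∧ e b' ≤ e b ∧ b' ≠ b},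
        node b m ≠ node b' m :=
      (eventually_all_finite hfin).2 fun b' hb' => eventually_node_ne hb'.2.2.symm
    obtain ⟨m₀, hm₀⟩ := eventually_atTop.1 hev
    let t : ℕ → ι := fun n => ⟨node b n, b, hb, rfl⟩
    have hlate : ∀ n ≥ m₀, β (t n) = b := by
      intro n hn
      by_contra hne
      exact hm₀ n hn _ ⟨hβB _, hβmin (t n) b hb rfl, hne⟩ (hβ (t n))
    -- Descent from height `m₀`, with `j` bounding the remaining distance.
    have hdown : ∀ j n, m₀ ≤ n + j → ∀ x, branchMap F b n x ∈ LinearMap.range Φ := by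
      intro j
      induction j with
      | zero =>
        intro n hn x
        have := hdirect (t n) x
        rwa [hlate n hn] at this
      | succ j ihj =>
        intro n hn x
        by_cases hbn : β (t n) = b
        · have := hdirect (t n) x
          rwa [hbn] at this
        -- The node is assigned an earlier branch. By induction the range contains both embeddings
        -- along it, hence their difference, which is the element supported at this node.
        · have hlt : e (β (t n)) < e b :=
            (hβmin (t n) b hb rfl).lt_of_ne fun h => hbn (he (hβB _) hb h)
          have hrange := ih _ (hk ▸ hlt) _ (hβB (t n)) rfl
          have h1 := branchMap_eq_single_add hid hcomp b n x
          have h2 := branchMap_eq_single_add hid hcomp (β (t n)) n x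
          -- Changing only the sequence and keeping the height fixed leaves the type `P n` of `x`
          -- untouched, which avoids casts.
          have hsingle : ∀ y z : Fin n → K, y = z →
              Pi.single (M := fun τ : Node K => P τ.1) ⟨n, y⟩ x = Pi.single ⟨n, z⟩ x := by
            rintro y _ rfl; rfl
          rw [← hsingle _ _ (eq_of_heq (Sigma.mk.inj (hβ (t n))).2)] at h2
          rw [h1]
          refine add_mem ?_ (ihj _ (by omega) _)
          rw [← sub_eq_iff_eq_add] at h2
          rw [← h2]
          exact sub_mem (hrange _ _) (hrange _ _)
    exact fun n x => hdown m₀ n (by omega) x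
  have hrange : LinearMap.range Φ = branchSum F B := by
    apply le_antisymm
    · rintro _ ⟨x, rfl⟩
      induction x using DirectSum.induction_on with
      | zero => rw [map_zero]; exact zero_mem _
      | of i x =>
        rw [← DirectSum.lof_eq_of S, DirectSum.toModule_lof]
        exact branchMap_mem_branchSum F (hβB i) _ _
      | add x y hx hy => rw [map_add]; exact add_mem hx hy
    · exact branchSum_le F fun b hb => hgen _ b hb rfl
  exact ⟨ι, hι, fun i => i.1.1,
    ⟨(LinearEquiv.ofInjective Φ hinj).trans (LinearEquiv.ofEq _ _ hrange)⟩⟩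

lemma branchSum_union (B B' : Set (ℕ → K)) :
    branchSum F (B ∪ B') = branchSum F B ⊔ branchSum F B' :=
  iSup_union

lemma branchSum_iUnion {ι : Sort*} (B : ι → Set (ℕ → K)) :
    branchSum F (⋃ i, B i) = ⨆ i, branchSum F (B i) :=
  iSup_iUnion _ _

lemma exists_countable_mem_branchSum {x : (τ : Node K) → P τ.1} (hx : x ∈ treeModule K F) :
    ∃ B : Set (ℕ → K), B.Countable ∧ x ∈ branchSum F B := by
  unfold treeModule branchSum at hx
  rw [iSup_subtype', Submodule.mem_iSup_iff_exists_finset] at hx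
  obtain ⟨s, hs⟩ := hx
  refine ⟨Subtype.val '' (s : Set (Set.univ : Set (ℕ → K))), (s.countable_toSet.image _), ?_⟩
  exact (iSup₂_le fun i hi => le_biSup (fun b => ⨆ n, LinearMap.range (branchMap F b n))
    (Set.mem_image_of_mem _ hi) : (⨆ i ∈ s, ⨆ n, LinearMap.range (branchMap F i.1 n)) ≤ _) hs

include hid hcomp in
-- The dense system consists of the submodules generated by countable sets of branches. It works
-- because every element involves finitely many branches and countable unions of countable sets are
-- countable.
lemma treeModule_hasDenseSystem {C : ObjectProperty (ModuleCat.{u} S)}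
    [C.IsClosedUnderIsomorphisms]
    (hC : ∀ (ι : Type u) [Countable ι] (d : ι → ℕ), C (ModuleCat.of S (⨁ i, P (d i)))) :
    HasDenseSystem (ℵ_ 1) C (ModuleCat.of S (treeModule K F)) := by
  let D : Set (Submodule S (treeModule K F)) :=
    {N | ∃ B : Set (ℕ → K), B.Countable ∧ N.map (treeModule K F).subtype = branchSum F B}
  have hD : ∀ B : Set (ℕ → K), B.Countable →
      ∃ N ∈ D, N.map (treeModule K F).subtype = branchSum F B := by
    intro B hB
    have : ((branchSum F B).comap (treeModule K F).subtype).map (treeModule K F).subtype =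
        branchSum F B := by
      rw [Submodule.map_comap_subtype, inf_eq_right]
      exact branchSum_mono F (Set.subset_univ B)
    exact ⟨_, ⟨B, hB, this⟩, this⟩
  refine ⟨D, ⟨?_, ?_, ?_⟩, ?_⟩
  · rintro N₁ ⟨B₁, hB₁, h₁⟩ N₂ ⟨B₂, hB₂, h₂⟩
    refine ⟨N₁ ⊔ N₂, ⟨B₁ ∪ B₂, hB₁.union hB₂, ?_⟩, le_sup_left, le_sup_right⟩
    rw [Submodule.map_sup, h₁, h₂, branchSum_union]
  · intro l _ hl c _ hc
    choose B hB hBc using hc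
    have : Countable (Set.Iio l) := by
      rw [← Cardinal.mk_le_aleph0_iff, Cardinal.mk_Iio_ordinal, Cardinal.lift_le_aleph0]
      have h := Cardinal.lt_ord.1 hl
      rwa [← Cardinal.succ_aleph0, Order.lt_succ_iff] at h
    refine ⟨⋃ α, B α, Set.countable_iUnion hB, ?_⟩
    rw [Submodule.map_iSup, branchSum_iUnion]
    exact iSup_congr hBc
  · intro X hX
    have hXc : Countable X := by
      rw [← Cardinal.mk_le_aleph0_iff]
      rwa [← Cardinal.succ_aleph0, Order.lt_succ_iff] at hX
    choose B hB hxB using fun x : X => exists_countable_mem_branchSum (F := F) x.1.2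
    obtain ⟨N, hN, hNB⟩ := hD (⋃ x, B x) (Set.countable_iUnion hB)
    refine ⟨N, hN, fun x hx => ?_⟩
    have h : (treeModule K F).subtype x ∈ N.map (treeModule K F).subtype := by
      rw [hNB]
      exact branchSum_mono F (Set.subset_iUnion B ⟨x, hx⟩) (hxB ⟨x, hx⟩)
    obtain ⟨y, hy, hyx⟩ := h
    rwa [← Subtype.ext hyx]
  · rintro N ⟨B, hB, h⟩
    obtain ⟨ι, hι, d, ⟨e⟩⟩ := exists_branchSum_equiv hid hcomp hB
    have e' : (⨁ i, P (d i)) ≃ₗ[S] N := e.trans ((LinearEquiv.ofEq _ _ h.symm).trans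
      (Submodule.equivMapOfInjective _ (Submodule.subtype_injective _) N).symm)
    exact C.prop_of_iso e'.toModuleIso (hC ι d)

end TreeModule

/-- Inverting `p` on `W` gives a section of `p`. -/
lemma nonempty_equiv_prod_of_bijective_restrict {S Q N : Type*} [Ring S] [AddCommGroup Q]
    [Module S Q] [AddCommGroup N] [Module S N] (p : Q →ₗ[S] N) (W : Submodule S Q)
    (hW : Function.Bijective (p.comp W.subtype)) : Nonempty (Q ≃ₗ[S] N × LinearMap.ker p) := by
  let s : N →ₗ[S] Q := W.subtype.comp (LinearEquiv.ofBijective _ hW).symm.toLinearMap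
  have hs : ∀ y, p (s y) = y := fun y => (LinearEquiv.ofBijective _ hW).apply_symm_apply y
  let r : Q →ₗ[S] LinearMap.ker p := (LinearMap.id - s.comp p).codRestrict _ fun z => by
    simp [hs]
  have hr : ∀ z, (r z : Q) = z - s (p z) := fun z => rfl
  refine ⟨LinearEquiv.ofBijective (p.prod r) ⟨fun a b hab => ?_, fun ⟨y, k⟩ => ⟨s y + k, ?_⟩⟩⟩
  · have h1 : p a = p b := congrArg Prod.fst hab
    have h2 : (r a : Q) = r b := congrArg Subtype.val (congrArg Prod.snd hab)
    rw [hr, hr, h1] at h2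
    exact sub_left_inj.1 h2
  · have hk : p k = 0 := k.2
    have h1 : p (s y + k) = y := by rw [map_add, hs, hk, add_zero]
    refine Prod.ext h1 (Subtype.ext ?_)
    change (r (s y + k) : Q) = k
    rw [hr, h1, add_sub_cancel_left]

/-! ### Limits along branches and the splitting of the quotient. -/

section Branches

open Filter

variable {S : Type u} [Ring S] {K : Type u} {P : ℕ → Type u} [∀ n, AddCommGroup (P n)]
  [∀ n, Module S (P n)] {F : ∀ n m, n ≤ m → P n →ₗ[S] P m} {N : Type u} [AddCommGroup N]
  [Module S N] (g : ∀ n, P n →ₗ[S] N)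

/-- The limit, in the colimit of the sequence, of the coordinates along a branch. -/
noncomputable def branchLimit (b : ℕ → K) :
    ((τ : Node K) → P τ.1) →ₗ[S] Germ (atTop : Filter ℕ) N where
  toFun x := ((fun m => g m (x (node b m)) : ℕ → N) : Germ atTop N)
  map_add' x y := by
    rw [← Germ.coe_add]; congr 1; funext m; exact map_add _ _ _
  map_smul' r x := by
    rw [RingHom.id_apply, ← Germ.coe_smul]; congr 1; funext m; exact map_smul _ _ _

/-- Constant germs. -/
noncomputable def constGerm (S N : Type u) [Ring S] [AddCommGroup N] [Module S N] :
    N →ₗ[S] Germ (atTop : Filter ℕ) N where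
  toFun y := ((fun _ => y : ℕ → N) : Germ atTop N)
  map_add' _ _ := rfl
  map_smul' _ _ := rfl

lemma constGerm_injective (S N : Type u) [Ring S] [AddCommGroup N] [Module S N] :
    Function.Injective (constGerm S N) := fun _ _ h => Germ.const_inj.1 h

lemma branchLimit_branchMap (hg : ∀ n m h x, g m (F n m h x) = g n x) (b : ℕ → K) (n : ℕ)
    (x : P n) : branchLimit g b (branchMap F b n x) = constGerm S N (g n x) := by
  refine Germ.coe_eq.2 ?_
  filter_upwards [eventually_ge_atTop n] with m hm
  rw [branchMap_apply_of_pos F b n x (node b m) hm rfl, hg]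

lemma branchLimit_branchMap_of_ne {b b' : ℕ → K} (h : b ≠ b') (n : ℕ) (x : P n) :
    branchLimit g b (branchMap F b' n x) = 0 := by
  refine Germ.coe_eq.2 ?_
  filter_upwards [eventually_node_ne h] with m hm
  rw [branchMap_apply_of_neg F b' n x (node b m) (fun h' => hm h'.2), map_zero]

/-- Two distinct branches share only finitely many nodes, so a generator has nonzero limit along at
most its own branch. -/
lemma finite_branchLimit_ne_zero {x : (τ : Node K) → P τ.1} (hx : x ∈ treeModule K F) :
    {b | branchLimit g b x ≠ 0}.Finite := by
  let W : Submodule S ((τ : Node K) → P τ.1) :=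
    { carrier := {x | {b | branchLimit g b x ≠ 0}.Finite}
      zero_mem' := by simp
      add_mem' := fun {x y} hx hy => (Set.Finite.union hx hy).subset fun b hb => by
        by_contra h
        simp only [Set.mem_union, Set.mem_ofPred_eq, not_or, not_not] at h
        exact hb (by rw [map_add, h.1, h.2, add_zero])
      smul_mem' := fun r x hx => Set.Finite.subset hx fun b hb h =>
        hb (by rw [map_smul, h, smul_zero]) }
  refine (branchSum_le F (W := W) fun b _ n x => ?_ : treeModule K F ≤ W) hx
  refine (Set.finite_singleton b).subset fun b' hb' => ?_
  by_contra h
  exact hb' (branchLimit_branchMap_of_ne g h n x)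

lemma branchLimit_mem_range (hg : ∀ n m h x, g m (F n m h x) = g n x) (b : ℕ → K)
    {x : (τ : Node K) → P τ.1} (hx : x ∈ treeModule K F) :
    branchLimit g b x ∈ LinearMap.range (constGerm S N) := by
  refine (branchSum_le F (W := (LinearMap.range (constGerm S N)).comap (branchLimit g b))
    fun b' _ n x => ?_ : treeModule K F ≤ _) hx
  rw [Submodule.mem_comap]
  by_cases h : b = b'
  · subst h
    rw [branchLimit_branchMap g hg]
    exact ⟨_, rfl⟩
  · rw [branchLimit_branchMap_of_ne g h]
    exact zero_mem _

/-- The elements of `L` together exclude at most `κ` of the `κ ^ ℵ₀` branches. -/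
lemma exists_branchLimit_eq_zero {κ : Cardinal.{u}} (hκ : ℵ₀ ≤ κ) (hK : #K = κ)
    (hκω : κ < κ ^ (ℵ₀ : Cardinal.{u})) (L : Submodule S (treeModule K F)) (hL : #L ≤ κ) :
    ∃ b : ℕ → K, ∀ x ∈ L, branchLimit g b x = 0 := by
  have h1 : #(⋃ x : L, {b : ℕ → K | branchLimit g b x ≠ 0}) ≤ κ :=
    mk_iUnion_le_of_le hκ _ hL fun x =>
      (Cardinal.lt_aleph0_iff_finite.2 (finite_branchLimit_ne_zero g x.1.2)).le.trans hκ
  have h2 : (⋃ x : L, {b : ℕ → K | branchLimit g b x ≠ 0}) ≠ Set.univ := by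
    intro h
    rw [h, Cardinal.mk_univ] at h1
    have h3 : #(ℕ → K) = κ ^ (ℵ₀ : Cardinal.{u}) := by simp [hK]
    exact absurd hκω (not_lt.2 (h3 ▸ h1))
  obtain ⟨b, hb⟩ := (Set.ne_univ_iff_exists_notMem _).1 h2
  refine ⟨b, fun x hx => ?_⟩
  by_contra h
  exact hb (Set.mem_iUnion.2 ⟨⟨x, hx⟩, h⟩)

variable (hid : ∀ n x, F n n le_rfl x = x)
  (hcomp : ∀ n m k (h : n ≤ m) (h' : m ≤ k) x, F m k h' (F n m h x) = F n k (h.trans h') x)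

open Classical in
include hid hcomp in
-- The element is a difference of two consecutive embeddings along a branch through `τ`.
lemma single_mem_treeModule [Nonempty K] (τ : Node K) (x : P τ.1) :
    Pi.single τ x ∈ treeModule K F := by
  obtain ⟨b, hb⟩ := exists_eq_node τ
  obtain ⟨n, y⟩ := τ
  obtain rfl : y = fun i : Fin n => b i := eq_of_heq (Sigma.mk.inj hb).2
  have h := branchMap_eq_single_add hid hcomp b n x
  rw [← sub_eq_iff_eq_add] at h
  rw [← h]
  exact sub_mem (branchMap_mem_branchSum F (Set.mem_univ b) _ _)
    (branchMap_mem_branchSum F (Set.mem_univ b) _ _)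

open Classical in
include hid hcomp in
/-- A small submodule of the tree module containing all the terms of the sequence misses a branch;
the colimit of the sequence is a direct summand of the quotient. -/
lemma nonempty_quotient_equiv_prod (hg : ∀ n m h x, g m (F n m h x) = g n x)
    (hsurj : ∀ y, ∃ n x, g n x = y) (hker : ∀ n x, g n x = 0 → ∃ m h, F n m h x = 0)
    (L : Submodule S (treeModule K F))
    (hL : ∀ (τ : Node K) (x : P τ.1), Pi.single τ x ∈ L.map (treeModule K F).subtype)
    (b : ℕ → K) (hb : ∀ x ∈ L, branchLimit g b x = 0) :
    ∃ K' : Type u, ∃ (_ : AddCommGroup K') (_ : Module S K'),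
      Nonempty ((treeModule K F ⧸ L) ≃ₗ[S] N × K') := by
  let q₀ : treeModule K F →ₗ[S] LinearMap.range (constGerm S N) :=
    ((branchLimit g b).comp (treeModule K F).subtype).codRestrict _
      fun x => branchLimit_mem_range g hg b x.2
  let E := LinearEquiv.ofInjective (constGerm S N) (constGerm_injective S N)
  let p : (treeModule K F ⧸ L) →ₗ[S] N := E.symm.toLinearMap.comp
    (L.liftQ q₀ fun x hx => LinearMap.mem_ker.2 (Subtype.ext (hb x hx)))
  have hp : ∀ x : treeModule K F, constGerm S N (p (L.mkQ x)) = branchLimit g b x := by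
    intro x
    exact congrArg Subtype.val (E.apply_symm_apply (q₀ x))
  let y : ∀ n, P n →ₗ[S] treeModule K F := fun n => (branchMap F b n).codRestrict _
    fun x => branchMap_mem_branchSum F (Set.mem_univ b) n x
  have hpy : ∀ n x, p (L.mkQ (y n x)) = g n x := fun n x => by
    apply constGerm_injective S N
    rw [hp]
    exact branchLimit_branchMap g hg b n x
  have hy : ∀ n m (h : n ≤ m) x, L.mkQ (y n x) = L.mkQ (y m (F n m h x)) := by
    intro n m h x
    refine (Submodule.Quotient.eq L).2 ?_
    obtain ⟨z, hz, hzx⟩ := branchMap_sub_mem hid hcomp hL b h x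
    rwa [← show z = y n x - y m (F n m h x) from Subtype.ext hzx]
  -- `W` is the image of the branch `b` in the quotient, and `p` restricts to an isomorphism from it
  -- onto `N`.
  let W : Submodule S (treeModule K F ⧸ L) := ⨆ n, LinearMap.range (L.mkQ.comp (y n))
  have hWmem : ∀ n x, L.mkQ (y n x) ∈ W := fun n x =>
    le_iSup (fun n => LinearMap.range (L.mkQ.comp (y n))) n ⟨x, rfl⟩
  have hWrep : ∀ z ∈ W, ∃ n x, L.mkQ (y n x) = z := by
    intro z hz
    have hmono : Monotone fun n => LinearMap.range (L.mkQ.comp (y n)) := by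
      rintro n m h _ ⟨x, rfl⟩
      exact ⟨F n m h x, (hy n m h x).symm⟩
    obtain ⟨n, x, hx⟩ := (Submodule.mem_iSup_of_directed _ hmono.directed_le).1 hz
    exact ⟨n, x, hx⟩
  refine ⟨LinearMap.ker p, inferInstance, inferInstance,
    nonempty_equiv_prod_of_bijective_restrict p W ⟨?_, ?_⟩⟩
  · rw [injective_iff_map_eq_zero]
    rintro ⟨z, hz⟩ h0
    obtain ⟨n, x, rfl⟩ := hWrep z hz
    have h1 : g n x = 0 := (hpy n x).symm.trans h0
    obtain ⟨m, h, hx⟩ := hker n x h1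
    apply Subtype.ext
    change L.mkQ (y n x) = 0
    rw [hy n m h, hx, map_zero, map_zero]
  · intro v
    obtain ⟨n, x, rfl⟩ := hsurj v
    exact ⟨⟨_, hWmem n x⟩, hpy n x⟩

end Branches

/-- A zero module has a filtration of length `0`, which has no factors to check. -/
lemma ClosedUnderTransfiniteExtensions.of_subsingleton {S : Type u} [Ring S]
    {A : ObjectProperty (ModuleCat.{u} S)} (hA : ClosedUnderTransfiniteExtensions A)
    (X : ModuleCat.{u} S) [Subsingleton X] : A X :=
  hA X ⟨0, fun _ => ⊥, ⟨rfl, fun _ _ _ _ => le_rfl, Subsingleton.elim _ _, fun _ _ _ => by simp⟩,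
    fun α hα => absurd hα (not_lt.2 (zero_le))⟩

/-- The colimit of a sequence of modules in `A'` belongs to `A`. -/
theorem sequential_colimit_mem {S : Type u} [Ring S] {A' A : ObjectProperty (ModuleCat.{u} S)}
    [A'.IsClosedUnderIsomorphisms]
    (hsum : ClosedUnderCountableDirectSums A') (hdec : IsDeconstructible A)
    (htrans : ClosedUnderTransfiniteExtensions A) (hsummand : ClosedUnderDirectSummands A)
    (hdense : ∀ M : ModuleCat.{u} S, HasDenseSystem (ℵ_ 1) A' M → A M)
    (P : ℕ → ModuleCat.{u} S) (hP : ∀ n, A' (P n)) (F : ∀ n m, n ≤ m → P n →ₗ[S] P m)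
    (hid : ∀ n x, F n n le_rfl x = x)
    (hcomp : ∀ n m k (h : n ≤ m) (h' : m ≤ k) x, F m k h' (F n m h x) = F n k (h.trans h') x)
    (N : ModuleCat.{u} S) (g : ∀ n, P n →ₗ[S] N)
    (hg : ∀ n m h x, g m (F n m h x) = g n x)
    (hsurj : ∀ y, ∃ n x, g n x = y) (hker : ∀ n x, g n x = 0 → ∃ m h, F n m h x = 0) : A N := by
  classical
  obtain ⟨μ, -, hμ⟩ := hdec
  -- The three bounds control the sizes of spans, of the filtration factors, and of the set of
  -- elements supported at one node.
  obtain ⟨κ, hcκ, hκ, hκω⟩ := exists_le_lt_pow_aleph0 (max (max #S μ) #(Σ n : ℕ, P n))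
  have hSκ : #S ≤ κ := (le_max_left _ _).trans ((le_max_left _ _).trans hcκ)
  have hμκ : μ ≤ κ := (le_max_right _ _).trans ((le_max_left _ _).trans hcκ)
  have hPκ : #(Σ n : ℕ, P n) ≤ κ := (le_max_right _ _).trans hcκ
  let K : Type u := κ.out
  have hK : #K = κ := Cardinal.mk_out κ
  have hKne : Nonempty K := Cardinal.mk_ne_zero_iff.1
    (hK ▸ (Cardinal.aleph0_pos.trans_le hκ).ne')
  let T : Submodule S ((τ : Node K) → P τ.1) := treeModule K F
  have hT : A (ModuleCat.of S T) :=
    hdense _ (treeModule_hasDenseSystem hid hcomp fun ι _ d => hsum ι (fun i => P (d i))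
      fun i => hP (d i))
  let single : (Σ τ : Node K, P τ.1) → T := fun z =>
    ⟨Pi.single z.1 z.2, single_mem_treeModule hid hcomp z.1 z.2⟩
  have hsingle : #(Set.range single) ≤ κ := by
    refine Cardinal.mk_range_le.trans ?_
    refine (Cardinal.mk_le_of_injective
      (f := fun z : (Σ τ : Node K, P τ.1) => ((z.1, ⟨z.1.1, z.2⟩) : Node K × (Σ n : ℕ, P n)))
      ?_).trans ?_
    · rintro ⟨τ, x⟩ ⟨τ', x'⟩ h
      obtain ⟨rfl, h⟩ := Prod.mk.inj h
      exact Sigma.ext rfl (Sigma.mk.inj h).2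
    · rw [← Cardinal.mul_def]
      exact (mul_le_mul' (mk_node_le hκ hK) hPκ).trans (Cardinal.mul_eq_self hκ).le
  obtain ⟨L, hXL, hLκ, hquot⟩ := exists_small_submodule_quotient_isTransfiniteExtension hκ hSκ
    (fun X hX => hX.2.mk_le hκ hSκ hμκ) (hμ _ hT) (Set.range single) hsingle
  obtain ⟨b, hb⟩ := exists_branchLimit_eq_zero g hκ hK hκω L hLκ
  obtain ⟨K', _, _, ⟨e⟩⟩ := nonempty_quotient_equiv_prod g hid hcomp hg hsurj hker L
    (fun τ x => ⟨single ⟨τ, x⟩, hXL ⟨_, rfl⟩, rfl⟩) b hb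
  refine hsummand (ModuleCat.of S (T ⧸ L)) N (ModuleCat.of S K') ⟨e⟩ (htrans _ ?_)
  obtain ⟨l, G, hG, hfac⟩ := hquot
  refine ⟨l, G, hG, fun α hα => ?_⟩
  obtain ⟨Y, hY | hY, h⟩ := hfac α hα
  · exact ⟨Y, hY.1, h⟩
  · exact ⟨Y, htrans.of_subsingleton Y, h⟩

end ModuleClass

/-- Right `R`-modules are modules over `Rᵐᵒᵖ`; classes of modules are object properties. -/
theorem mainTheorem5 {R : Type u} [Ring R]
    (A' A : ObjectProperty (ModuleCat.{u} Rᵐᵒᵖ))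
    [A'.IsClosedUnderIsomorphisms] [A.IsClosedUnderIsomorphisms]
    (hle : A' ≤ A)
    (hsum : ModuleClass.ClosedUnderCountableDirectSums A')
    (hdec : ModuleClass.IsDeconstructible A)
    (htrans : ModuleClass.ClosedUnderTransfiniteExtensions A)
    (hsummand : ModuleClass.ClosedUnderDirectSummands A)
    (hdense : ∀ M : ModuleCat.{u} Rᵐᵒᵖ, ModuleClass.HasDenseSystem (ℵ_ 1) A' M → A M)
    {I : Type w} [Preorder I] [Nonempty I] [IsDirectedOrder I] [Countable I] [DecidableEq I]
    (G : I → ModuleCat.{u} Rᵐᵒᵖ)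
    (f : ∀ i j, i ≤ j → G i →ₗ[Rᵐᵒᵖ] G j)
    [DirectedSystem (fun i => (G i : Type u)) fun i j h => f i j h]
    (hG : ∀ i, A' (G i))
    (N : ModuleCat.{u} Rᵐᵒᵖ)
    (e : N ≃ₗ[Rᵐᵒᵖ] Module.DirectLimit (fun i => (G i : Type u)) f) :
    A N := by
  obtain ⟨s, hs, hcof⟩ := Filter.exists_seq_monotone_tendsto_atTop_atTop I
  have hcof' : ∀ i, ∃ n, i ≤ s n := fun i => (hcof.eventually_ge_atTop i).exists
  refine ModuleClass.sequential_colimit_mem hsum hdec htrans hsummand hdense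
    (fun n => G (s n)) (fun n => hG _) (fun n m h => f _ _ (hs h))
    (fun n x => DirectedSystem.map_self (f := fun i j h => f i j h) x)
    (fun n m k h h' x => DirectedSystem.map_map (f := fun i j h => f i j h) (hs h) (hs h') x) N
    (fun n => e.symm.toLinearMap.comp (Module.DirectLimit.of Rᵐᵒᵖ I (fun i => (G i : Type u)) f _))
    (fun n m h x => ?_) (fun y => ?_) (fun n x hx => ?_)
  · exact congrArg e.symm Module.DirectLimit.of_f
  · obtain ⟨i, z, hz⟩ := Module.DirectLimit.exists_of (e y)
    obtain ⟨n, hn⟩ := hcof' i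
    refine ⟨n, f i _ hn z, ?_⟩
    change e.symm (Module.DirectLimit.of Rᵐᵒᵖ I (fun i => (G i : Type u)) f _ _) = y
    rw [Module.DirectLimit.of_f, hz, e.symm_apply_apply]
  · have h0 : Module.DirectLimit.of Rᵐᵒᵖ I (fun i => (G i : Type u)) f (s n) x = 0 :=
      e.symm.map_eq_zero_iff.1 hx
    -- The element dies at some `j` that need not be on the sequence. It is pushed on to a term `s
    -- k` beyond `j` with `k ≥ n`.
    obtain ⟨j, hj, hz⟩ := Module.DirectLimit.of.zero_exact h0
    obtain ⟨m, hm⟩ := hcof' j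
    obtain ⟨k, hnk, hmk⟩ := exists_ge_ge n m
    refine ⟨k, hnk, ?_⟩
    have h1 := DirectedSystem.map_map (f := fun i j h => f i j h) hj (hm.trans (hs hmk)) x
    rw [hz, map_zero] at h1
    exact h1.symm
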